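/- Let $q=p^m$ be a prime power, let $r\ge 3$ be an integer, and put $n_r=(q^r-1)/(q-1)$. Let $G\in\mathbb F_q^{r\times n_r}$ be a generator matrix of the $q$-ary simplex code $S(q,r)$: the columns of $G$ are nonzero representatives of the points of the projective space $PG(r-1,q)$, exactly one for each point. Let $H$ be a parity-check matrix of this code over $\mathbb F_q$, i.e. $\ker H=\{c : Hc=0\}$ is the row space of $G$. Let $\mathcal P$ be the Pauli group of Galois qudits of dimension $q$ arranged on an $n_r\times n_r$ lattice. It consists of the operators $c\,Z^{b}X^{a}$ with $a,b\in\mathbb F_q^{n_r}\otimes\mathbb F_q^{n_r}$, where $X^a|x\rangle=|x+a\rangle$ and $Z^b|x\rangle=\omega^{\operatorname{Tr}(b\cdot x)}|x\rangle$ with $\omega=e^{2\pi i/p}$, and where $c$ is a power of $\omega$ (for $q$ even, a power of $i$). Let $\mathcal G\le\mathcal P$ be the gauge group of the subsystem hypergraph product of two copies of $H$: it is generated by all the phases $c$, all $X^a$ with $a$ in the $\mathbb F_q$-row space of $G_X=H\otimes I_{n_r}$, and all $Z^b$ with $b$ in the $\mathbb F_q$-row space of $G_Z=I_{n_r}\otimes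 H$. Let $\mathcal S$ be the group generated by the operators $X^a$ and $Z^b$ (without phases) that lie in the center $Z(\mathcal G)=C_{\mathcal P}(\mathcal G)\cap\mathcal G$. Then $(\mathcal G,\mathcal S)$ defines a quantum subsystem code, $\mathrm{SHYPS}(q,r)$, with parameters $[[n,k,d]]_q$, where $$n=\left(\frac{q^r-1}{q-1}\right)^2,\qquad k=r^2,\qquad d=q^{r-1}.$$ That is: 1. The number of physical qudits is $n$. 2. $\mathcal S$ contains no scalar operator other than the identity, and together with the phases it generates $Z(\mathcal G)$. 3. For some $g\ge 0$ there is a unitary isomorphism of the space of states fixed by $\mathcal S$ with $C_L\otimes C_G$, where $C_L=(\mathbb C^q)^{\otimes k}$ consists of $k$ logical qudits and $C_G=(\mathbb C^q)^{\otimes g}$ of $g$ gauge qudits. Under it, $\mathcal G$ acts as exactly the Pauli group of the gauge qudits (with the identity on $C_L$), and $C_{\mathcal P}(\mathcal G)$ acts as exactly the Pauli group of the logical qudits (with the identity on $C_G$). 4. The minimum weight of an element of $C_{\mathcal P}(\mathcal S)\setminus\mathcal G$ is equal to $d$, where the weight of an operator is the number of its tensor factors that are not multiples of the identity. -/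

import Mathlib

open scoped Kronecker

noncomputable section

namespace Qudit

/-! ### Galois qudits and their Pauli group -/

section Pauli

variable (p : ℕ) [Fact p.Prime] {F : Type*} [Field F] [Algebra (ZMod p) F] {Q : Type*}

/-- The Hilbert space `(ℂ^q)^{⊗ Q}` of a finite family `Q` of Galois qudits over the finite field
`F`. Its orthonormal basis `|x⟩ = ⊗_j |x_j⟩` is indexed by the vectors `x : Q → F`, and a state is
given by its amplitudes in this basis. -/
abbrev Space (F Q : Type*) : Type _ := EuclideanSpace ℂ (Q → F)

/-- The character `α ↦ ω ^ Tr α` of `F`, where `ω = exp (2πi / p)` and `Tr : F → 𝔽_p` is the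
field trace. -/
def chr (α : F) : ℂ := ZMod.stdAddChar (Algebra.trace (ZMod p) F α)

lemma chr_add (α β : F) : chr p (α + β) = chr p α * chr p β := by
  simp [chr, AddChar.map_add_eq_mul]

lemma chr_zero : chr p (0 : F) = 1 := by simp [chr]

lemma chr_pow (α : F) : chr p α ^ p = 1 := by
  rw [chr, ← AddChar.map_nsmul_eq_pow]
  simp

lemma chr_neg_mul (α : F) : chr p (-α) * chr p α = 1 := by
  rw [← chr_add, neg_add_cancel, chr_zero]

/-- The operator `⊗_j X^{a_j}`, that is, `|x⟩ ↦ |x + a⟩`. -/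
def X (a : Q → F) : Space F Q ≃ₗ[ℂ] Space F Q where
  toFun ψ := WithLp.toLp 2 fun x => ψ (x - a)
  invFun ψ := WithLp.toLp 2 fun x => ψ (x + a)
  map_add' ψ φ := by ext x; simp
  map_smul' c ψ := by ext x; simp
  left_inv ψ := by ext x; simp
  right_inv ψ := by ext x; simp

@[simp] lemma X_apply (a : Q → F) (ψ : Space F Q) (x : Q → F) : X a ψ x = ψ (x - a) := rfl

/-- Multiplication by a nonzero scalar. -/
def phase {F Q : Type*} (c : ℂˣ) : Space F Q ≃ₗ[ℂ] Space F Q := LinearEquiv.smulOfUnit c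

@[simp] lemma phase_apply {F Q : Type*} (c : ℂˣ) (ψ : Space F Q) (x : Q → F) :
    phase c ψ x = (c : ℂ) * ψ x := rfl

/-- The phases of the Pauli group: the powers of `ω`, together with their multiples by `i` if the
characteristic is `2`. These are the `p`-th roots of unity for odd `p`, and the fourth roots of
unity for `p = 2`. -/
def phases : Subgroup ℂˣ := rootsOfUnity (if p = 2 then 4 else p) ℂ

lemma exists_phase_chr (α : F) : ∃ u ∈ phases p, (u : ℂ) = chr p α := by
  have h := chr_pow p α
  refine ⟨Units.mk0 (chr p α) ?_, ?_, rfl⟩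
  · intro h0
    rw [h0, zero_pow (Fact.out : p.Prime).ne_zero] at h
    exact zero_ne_one h
  · rw [phases, mem_rootsOfUnity, Units.ext_iff]
    split_ifs with h2
    · subst h2
      simp only [Units.val_pow_eq_pow_val, Units.val_mk0, Units.val_one]
      rw [show 4 = 2 * 2 from rfl, pow_mul, h, one_pow]
    · simpa using h

variable [Fintype Q]

/-- The operator `⊗_j Z^{b_j}`, that is, `|x⟩ ↦ ω ^ Tr (∑ j, b_j x_j) |x⟩`. -/
def Z (b : Q → F) : Space F Q ≃ₗ[ℂ] Space F Q where
  toFun ψ := WithLp.toLp 2 fun x => chr p (b ⬝ᵥ x) * ψ x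
  invFun ψ := WithLp.toLp 2 fun x => chr p (-(b ⬝ᵥ x)) * ψ x
  map_add' ψ φ := by ext x; simp [mul_add]
  map_smul' c ψ := by ext x; simp [mul_left_comm]
  left_inv ψ := by ext x; simp [← mul_assoc, chr_neg_mul]
  right_inv ψ := by
    ext x
    change chr p (b ⬝ᵥ x) * (chr p (-(b ⬝ᵥ x)) * ψ x) = ψ x
    rw [mul_left_comm, ← mul_assoc, chr_neg_mul, one_mul]

/-- The operator `c ⊗_j Z^{b_j} X^{a_j}`. -/
def pauli (c : ℂˣ) (b a : Q → F) : Space F Q ≃ₗ[ℂ] Space F Q := phase c * Z p b * X a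

@[simp] lemma Z_apply (b : Q → F) (ψ : Space F Q) (x : Q → F) :
    Z p b ψ x = chr p (b ⬝ᵥ x) * ψ x := rfl

lemma pauli_apply (c : ℂˣ) (b a : Q → F) (ψ : Space F Q) (x : Q → F) :
    pauli p c b a ψ x = (c : ℂ) * (chr p (b ⬝ᵥ x) * ψ (x - a)) := rfl

variable (F Q) in
/-- The Pauli group of the family `Q` of Galois qudits over `F`. -/
def pauliGroup : Subgroup (Space F Q ≃ₗ[ℂ] Space F Q) where
  carrier := {U | ∃ c ∈ phases p, ∃ b a : Q → F, U = pauli p c b a}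
  one_mem' := by
    refine ⟨1, one_mem _, 0, 0, ?_⟩
    ext ψ x
    simp [pauli_apply, chr_zero]
  mul_mem' := by
    rintro _ _ ⟨c, hc, b, a, rfl⟩ ⟨c', hc', b', a', rfl⟩
    obtain ⟨u, hu, hu'⟩ := exists_phase_chr p (-(b' ⬝ᵥ a))
    refine ⟨c * c' * u, mul_mem (mul_mem hc hc') hu, b + b', a + a', ?_⟩
    ext ψ x
    have h : chr p (b' ⬝ᵥ (x - a)) = chr p (b' ⬝ᵥ x) * chr p (-(b' ⬝ᵥ a)) := by
      rw [← chr_add, dotProduct_sub, sub_eq_add_neg]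
    simp only [LinearEquiv.mul_apply, pauli_apply, h, add_dotProduct, chr_add, Units.val_mul, hu',
      sub_add_eq_sub_sub]
    ring
  inv_mem' := by
    rintro _ ⟨c, hc, b, a, rfl⟩
    obtain ⟨u, hu, hu'⟩ := exists_phase_chr p (-(b ⬝ᵥ a))
    refine ⟨c⁻¹ * u, mul_mem (inv_mem hc) hu, -b, -a, ?_⟩
    rw [inv_eq_iff_mul_eq_one]
    ext ψ x
    have h : chr p (-b ⬝ᵥ (x - a)) = chr p (-(b ⬝ᵥ x)) * chr p (b ⬝ᵥ a) := by
      rw [← chr_add, dotProduct_sub, neg_dotProduct, neg_dotProduct, sub_neg_eq_add]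
    have h1 := chr_neg_mul p (b ⬝ᵥ x)
    have h2 := chr_neg_mul p (b ⬝ᵥ a)
    simp only [LinearEquiv.mul_apply, pauli_apply, h, Units.val_mul, hu',
      LinearEquiv.coe_one, id_eq, sub_neg_eq_add, sub_add_cancel]
    linear_combination
      (chr p (-(b ⬝ᵥ x)) * chr p (b ⬝ᵥ x) * chr p (-(b ⬝ᵥ a)) * chr p (b ⬝ᵥ a) * ψ x) *
        c.mul_inv + (chr p (-(b ⬝ᵥ a)) * chr p (b ⬝ᵥ a) * ψ x) * h1 + ψ x * h2

/-- The group of the scalar operators `c • 1` with `c` a phase of the Pauli group. -/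
def phaseGroup : Subgroup (Space F Q ≃ₗ[ℂ] Space F Q) where
  carrier := {U | ∃ c ∈ phases p, U = phase c}
  one_mem' := ⟨1, one_mem _, by ext ψ x; simp⟩
  mul_mem' := by
    rintro _ _ ⟨c, hc, rfl⟩ ⟨d, hd, rfl⟩
    exact ⟨c * d, mul_mem hc hd, by ext ψ x; simp [mul_assoc]⟩
  inv_mem' := by
    rintro _ ⟨c, hc, rfl⟩
    exact ⟨c⁻¹, inv_mem hc, by rw [inv_eq_iff_mul_eq_one]; ext ψ x; simp⟩

/-- The centralizer `C_P(𝒢)` of `𝒢` in the Pauli group. -/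
def pauliCentralizer (𝒢 : Subgroup (Space F Q ≃ₗ[ℂ] Space F Q)) :
    Subgroup (Space F Q ≃ₗ[ℂ] Space F Q) :=
  pauliGroup p F Q ⊓ Subgroup.centralizer (𝒢 : Set (Space F Q ≃ₗ[ℂ] Space F Q))

/-- The number of tensor factors at which `c ⊗_j Z^{b_j} X^{a_j}` is not a multiple of the
identity. -/
def weight (b a : Q → F) : ℕ := {j : Q | b j ≠ 0 ∨ a j ≠ 0}.ncard

/-! ### Subsystem codes -/

/-- The center `C_P(𝒢) ∩ 𝒢` of a gauge group `𝒢`. -/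
def gaugeCenter (𝒢 : Subgroup (Space F Q ≃ₗ[ℂ] Space F Q)) :
    Subgroup (Space F Q ≃ₗ[ℂ] Space F Q) :=
  pauliCentralizer p 𝒢 ⊓ 𝒢

/-- `S` is a stabilizer group of the gauge group `𝒢`: it is the center of `𝒢` up to phases, and
contains no scalar operator except the identity. -/
structure IsStabilizerOf (𝒢 S : Subgroup (Space F Q ≃ₗ[ℂ] Space F Q)) : Prop where
  sup_phases : S ⊔ phaseGroup p = gaugeCenter p 𝒢
  inf_phases : S ⊓ phaseGroup p = ⊥

/-- The space of the states that are fixed by all elements of `S`. -/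
def codeSpace (S : Subgroup (Space F Q ≃ₗ[ℂ] Space F Q)) : Submodule ℂ (Space F Q) where
  carrier := {ψ | ∀ U ∈ S, U ψ = ψ}
  zero_mem' U _ := map_zero U
  add_mem' hψ hφ U hU := by rw [map_add, hψ U hU, hφ U hU]
  smul_mem' c ψ hψ U hU := by rw [map_smul, hψ U hU]

variable [Fintype F] [DecidableEq Q]

/-- The code space of `S` is, for the gauge group `𝒢`, the state space `C_L ⊗ C_G` of `k` logical
and `g` gauge qudits, indexed here by `Fin k ⊕ Fin g` (so that `Space F (Fin k ⊕ Fin g)` is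
`Space F (Fin k) ⊗ Space F (Fin g)` in the basis `|x⟩ ⊗ |y⟩`): up to a unitary identification of
the two spaces, the gauge operators act on the code space as the Pauli operators of the gauge
qudits, with the identity on `C_L`, and the bare logical operators, which are the elements of
`C_P(𝒢)`, act as the Pauli operators of the logical qudits, with the identity on `C_G`. In both
cases all Pauli operators of these qudits occur. -/
def Encodes (𝒢 S : Subgroup (Space F Q ≃ₗ[ℂ] Space F Q)) (k g : ℕ) : Prop :=
  ∃ Φ : Space F (Fin k ⊕ Fin g) ≃ₗᵢ[ℂ] codeSpace S,
    (∀ U ∈ 𝒢, ∃ c ∈ phases p, ∃ b a : Fin g → F, ∀ ψ,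
      U (Φ ψ) = Φ (pauli p c (Sum.elim 0 b) (Sum.elim 0 a) ψ)) ∧
    (∀ c ∈ phases p, ∀ b a : Fin g → F, ∃ U ∈ 𝒢, ∀ ψ,
      U (Φ ψ) = Φ (pauli p c (Sum.elim 0 b) (Sum.elim 0 a) ψ)) ∧
    (∀ U ∈ pauliCentralizer p 𝒢, ∃ c ∈ phases p, ∃ b a : Fin k → F, ∀ ψ,
      U (Φ ψ) = Φ (pauli p c (Sum.elim b 0) (Sum.elim a 0) ψ)) ∧
    (∀ c ∈ phases p, ∀ b a : Fin k → F, ∃ U ∈ pauliCentralizer p 𝒢, ∀ ψ,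
      U (Φ ψ) = Φ (pauli p c (Sum.elim b 0) (Sum.elim a 0) ψ))

/-- The gauge group `𝒢`, with stabilizer group `S`, defines a quantum subsystem code over `F` with
`n` physical qudits, `k` logical qudits and distance `d`. The distance is the least weight of the
dressed logical operators, which are the elements of `C_P(S) \ 𝒢`. -/
structure IsSubsystemCode (𝒢 S : Subgroup (Space F Q ≃ₗ[ℂ] Space F Q)) (n k d : ℕ) : Prop where
  gauge_le : 𝒢 ≤ pauliGroup p F Q
  stabilizer : IsStabilizerOf p 𝒢 S
  length : Fintype.card Q = n
  encodes : ∃ g : ℕ, Encodes p 𝒢 S k g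
  distance : IsLeast {w : ℕ | ∃ c ∈ phases p, ∃ b a : Q → F,
    pauli p c b a ∈ pauliCentralizer p S ∧ pauli p c b a ∉ 𝒢 ∧ weight b a = w} d

/-! ### Subsystem CSS codes -/

/-- The space spanned over `F` by the rows of a matrix. -/
def rowSpace {ρ κ : Type*} (A : Matrix ρ κ F) : Submodule F (κ → F) :=
  Submodule.span F (Set.range fun i => A i)

/-- The gauge group of the subsystem CSS code with gauge generator matrices `GX` and `GZ`. It is
generated by the phases, the `X^a` with `a` in the row space of `GX` and the `Z^b` with `b` in the
row space of `GZ`. -/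
def cssGauge {ρ σ : Type*} (GX : Matrix ρ Q F) (GZ : Matrix σ Q F) :
    Subgroup (Space F Q ≃ₗ[ℂ] Space F Q) :=
  phaseGroup p ⊔ Subgroup.closure
    (X '' (rowSpace GX : Set (Q → F)) ∪ Z p '' (rowSpace GZ : Set (Q → F)))

/-- The stabilizer group of a CSS gauge group, with the usual choice of signs: it is generated by
the operators `X^a` and `Z^b`, without phases, that lie in the center of `𝒢`. -/
def cssStabilizer (𝒢 : Subgroup (Space F Q ≃ₗ[ℂ] Space F Q)) :
    Subgroup (Space F Q ≃ₗ[ℂ] Space F Q) :=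
  Subgroup.closure ((Set.range X ∪ Set.range (Z p)) ∩ gaugeCenter p 𝒢)

end Pauli

/-! ### Simplex codes and the subsystem hypergraph product -/

section Simplex

variable {F : Type*} [Field F] {ι κ : Type*} {r : ℕ}

/-- `G` is a generator matrix of the simplex code of dimension `r` over `F`: its columns are
representatives of the points of the projective space `PG(r - 1, F)`, one for each point. -/
def IsSimplexGenerator (G : Matrix (Fin r) ι F) : Prop :=
  ∃ h : ∀ j, G.col j ≠ 0,
    Function.Bijective fun j => Projectivization.mk F (G.col j) (h j)

/-- `H` is a parity-check matrix of the linear code `C`: the code is the kernel of `H`. -/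
def IsParityCheck [Fintype ι] (H : Matrix κ ι F) (C : Submodule F (ι → F)) : Prop :=
  ∀ c : ι → F, c ∈ C ↔ H.mulVec c = 0

end Simplex

/-- The gauge group of the subsystem hypergraph product of two copies of `H`: the qudits form the
lattice `ι × ι`, and the gauge generators are `GX = H ⊗ I` and `GZ = I ⊗ H`. -/
def shpGauge (p : ℕ) [Fact p.Prime] {F : Type*} [Field F] [Fintype F] [Algebra (ZMod p) F]
    {ι κ : Type*} [Fintype ι] [DecidableEq ι] (H : Matrix κ ι F) :
    Subgroup (Space F (ι × ι) ≃ₗ[ℂ] Space F (ι × ι)) :=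
  cssGauge p (H ⊗ₖ (1 : Matrix ι ι F)) ((1 : Matrix ι ι F) ⊗ₖ H)

end Qudit

end

open scoped Kronecker

noncomputable section

/-! Up to phases the gauge group is a pair of subspaces: `W`, the row space of `GZ`, and `U`, the
row space of `GX`. Commutation of Pauli operators is orthogonality, because the trace form is
nondegenerate and the subspaces are stable under scalars from `F`. So the bare logicals are the pair
(`U^⊥`, `W^⊥`), the stabilizers (`W ∩ U^⊥`, `U ∩ W^⊥`), and the dressed logicals (`U^⊥ + W`, `W^⊥ +
U`).

For any such pair (`exists_encodes`), a code state is a function supported on `D = (W ∩ U^⊥)^⊥` and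
invariant under `U ∩ W^⊥`, that is, a function on the quotient. Complements of `W ∩ U^⊥` in `U^⊥`
and in `W` give logical and gauge coordinates on this quotient, hence the tensor factorization.

For the product code, view lattice vectors as matrices. Then `U^⊥` consists of the matrices with
columns in the simplex code, and `W` of those whose rows are orthogonal to it; `U^⊥ / (W ∩ U^⊥)` is
the space of `r × r` matrices (`exists_isComplementMap_logical`). A row of `G` contracts a dressed
logical outside the gauge group to a nonzero codeword supported on its nonzero columns (or rows).
Nonzero codewords have weight `q^(r-1)` (`IsSimplexGenerator.ncard_support`), and a single codeword
placed in one row attains the bound. -/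

namespace Qudit

/-! ### Orthogonal complements in `F^Q` -/

section Perp

variable {F : Type*} [Field F] {Q : Type*} [Fintype Q]

/-- The orthogonal complement of a subspace of `F^Q` for the dot product. -/
def perp (W : Submodule F (Q → F)) : Submodule F (Q → F) where
  carrier := {x | ∀ w ∈ W, w ⬝ᵥ x = 0}
  zero_mem' w _ := dotProduct_zero w
  add_mem' hx hy w hw := by rw [dotProduct_add, hx w hw, hy w hw, add_zero]
  smul_mem' c x hx w hw := by rw [dotProduct_smul, hx w hw, smul_zero]

lemma mem_perp {W : Submodule F (Q → F)} {x : Q → F} : x ∈ perp W ↔ ∀ w ∈ W, w ⬝ᵥ x = 0 :=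
  Iff.rfl

lemma mem_perp' {W : Submodule F (Q → F)} {x : Q → F} : x ∈ perp W ↔ ∀ w ∈ W, x ⬝ᵥ w = 0 := by
  simp only [mem_perp, dotProduct_comm]

/-- A vector outside `W` is separated from it by a functional vanishing on `W`, and every functional
on `F^Q` is a dot product. -/
lemma perp_perp (W : Submodule F (Q → F)) : perp (perp W) = W := by
  classical
  refine le_antisymm (fun x hx => ?_) fun x hx => mem_perp'.2 fun w hw => hw x hx
  by_contra hxW
  obtain ⟨f, hfx, hf⟩ := Submodule.exists_le_ker_of_notMem hxW
  obtain ⟨v, rfl⟩ := (dotProductEquiv F Q).surjective f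
  exact hfx (hx v (mem_perp'.2 fun w hw => hf hw))

lemma perp_anti {W W' : Submodule F (Q → F)} (h : W ≤ W') : perp W' ≤ perp W :=
  fun _ hx w hw => hx w (h hw)

lemma perp_sup (W W' : Submodule F (Q → F)) : perp (W ⊔ W') = perp W ⊓ perp W' := by
  refine le_antisymm (le_inf (perp_anti le_sup_left) (perp_anti le_sup_right)) ?_
  rintro x ⟨h, h'⟩ w hw
  obtain ⟨y, hy, z, hz, rfl⟩ := Submodule.mem_sup.1 hw
  rw [add_dotProduct, h y hy, h' z hz, add_zero]

lemma perp_inf (W W' : Submodule F (Q → F)) : perp (W ⊓ W') = perp W ⊔ perp W' := by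
  rw [← perp_perp (perp W ⊔ perp W'), perp_sup, perp_perp, perp_perp]

/-- The orthogonal complement of the row space of a matrix is its kernel. -/
lemma mem_perp_rowSpace {ρ : Type*} (A : Matrix ρ Q F) (x : Q → F) :
    x ∈ perp (rowSpace A) ↔ A.mulVec x = 0 := by
  constructor
  · intro h
    ext i
    exact h _ (Submodule.subset_span ⟨i, rfl⟩)
  · intro h w hw
    induction hw using Submodule.span_induction with
    | mem w hw => obtain ⟨i, rfl⟩ := hw; exact congrFun h i
    | zero => exact zero_dotProduct x
    | add y z _ _ hy hz => rw [add_dotProduct, hy, hz, add_zero]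
    | smul c y _ hy => rw [smul_dotProduct, hy, smul_zero]

/-- A linear map into `F^m` is onto a subspace `V` if no nonzero functional vanishes on it. -/
lemma exists_mem_eq_of_dotProduct {V : Type*} [AddCommGroup V] [Module F V] (f : V →ₗ[F] (Q → F))
    (S : Submodule F V) (h : ∀ c : Q → F, (∀ v ∈ S, c ⬝ᵥ f v = 0) → c = 0) (y : Q → F) :
    ∃ v ∈ S, f v = y := by
  have : perp (S.map f) = ⊥ := by
    rw [eq_bot_iff]
    intro c hc
    exact h c fun v hv => mem_perp'.1 hc _ (Submodule.mem_map_of_mem hv)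
  have hy : y ∈ S.map f := by
    rw [← perp_perp (S.map f), this, mem_perp]
    rintro w rfl
    exact zero_dotProduct y
  exact hy

end Perp

/-! ### Pauli operators as pairs of subspaces -/

section Pauli

variable (p : ℕ) [Fact p.Prime] {F : Type*} [Field F] [Algebra (ZMod p) F] {Q : Type*}

lemma chr_eq_one_iff (α : F) : chr p α = 1 ↔ Algebra.trace (ZMod p) F α = 0 := by
  rw [chr, ← (ZMod.stdAddChar (N := p)).map_zero_eq_one, ZMod.injective_stdAddChar.eq_iff]

lemma chr_ne_zero (α : F) : chr p α ≠ 0 := right_ne_zero_of_mul_eq_one (chr_neg_mul p α)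

lemma eq_zero_of_chr_mul [Finite F] {α : F} (h : ∀ t : F, chr p (t * α) = 1) : α = 0 := by
  have : Module.Finite (ZMod p) F := Module.Finite.of_finite
  refine (traceForm_nondegenerate (ZMod p) F).2 α fun t => ?_
  rw [Algebra.traceForm_apply]
  exact (chr_eq_one_iff p _).1 (h t)

variable [Fintype Q]

/-- Commutation only sees the trace of a dot product. Scaling `w` inside `W` and nondegeneracy of
the trace form recover the dot product itself. -/
lemma mem_perp_iff_chr [Finite F] (W : Submodule F (Q → F)) (x : Q → F) :
    x ∈ perp W ↔ ∀ w ∈ W, chr p (w ⬝ᵥ x) = 1 := by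
  refine ⟨fun h w hw => by rw [h w hw, chr_zero], fun h w hw => eq_zero_of_chr_mul p fun t => ?_⟩
  rw [← smul_eq_mul, ← smul_dotProduct]
  exact h _ (W.smul_mem t hw)

lemma pauli_mul (c c' u : ℂˣ) (b a b' a' : Q → F) (hu : (u : ℂ) = chr p (-(b' ⬝ᵥ a))) :
    pauli p c b a * pauli p c' b' a' = pauli p (c * c' * u) (b + b') (a + a') := by
  ext ψ x
  have h : chr p (b' ⬝ᵥ (x - a)) = chr p (b' ⬝ᵥ x) * chr p (-(b' ⬝ᵥ a)) := by
    rw [← chr_add, dotProduct_sub, sub_eq_add_neg]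
  simp only [LinearEquiv.mul_apply, pauli_apply, h, add_dotProduct, chr_add, Units.val_mul, hu,
    sub_add_eq_sub_sub]
  ring

lemma pauli_mul_of_dotProduct (c c' : ℂˣ) (b a b' a' : Q → F) (h : b' ⬝ᵥ a = 0) :
    pauli p c b a * pauli p c' b' a' = pauli p (c * c') (b + b') (a + a') := by
  rw [pauli_mul p c c' 1 b a b' a' (by simp [h, chr_zero]), mul_one]

lemma pauli_one_zero_left (a : Q → F) : pauli p 1 0 a = X a := by
  ext ψ x; simp [pauli_apply, chr_zero]

lemma pauli_one_zero_right (b : Q → F) : pauli p 1 b 0 = Z p b := by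
  ext ψ x; simp [pauli_apply]

lemma pauli_zero_zero (c : ℂˣ) : pauli p c (0 : Q → F) 0 = phase c := by
  ext ψ x; simp [pauli_apply, chr_zero]

lemma pauli_injective [Finite F] {c c' : ℂˣ} {b a b' a' : Q → F}
    (h : pauli p c b a = pauli p c' b' a') : c = c' ∧ b = b' ∧ a = a' := by
  classical
  -- Both operators are evaluated on the basis state `|y⟩`, at the amplitude of `|x⟩`.
  have key (y x : Q → F) : (c : ℂ) * (chr p (b ⬝ᵥ x) * if x - a = y then 1 else 0) =
      c' * (chr p (b' ⬝ᵥ x) * if x - a' = y then 1 else 0) :=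
    congrFun (congrArg WithLp.ofLp
      (LinearEquiv.congr_fun h (WithLp.toLp 2 fun x => if x = y then 1 else 0))) x
  have ha : a = a' := by
    by_contra hne
    have := key 0 a
    rw [if_pos (sub_self a), if_neg (by rwa [sub_eq_zero])] at this
    simp [chr_ne_zero] at this
  subst ha
  have key2 (x : Q → F) : (c : ℂ) * chr p (b ⬝ᵥ x) = c' * chr p (b' ⬝ᵥ x) := by
    simpa using key (x - a) x
  have hc : c = c' := Units.ext (by simpa [chr_zero] using key2 0)
  subst hc
  refine ⟨rfl, ?_, rfl⟩
  rw [← sub_eq_zero]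
  have : b - b' ∈ perp (⊤ : Submodule F (Q → F)) := by
    rw [mem_perp_iff_chr p]
    intro x _
    rw [dotProduct_comm, sub_dotProduct, sub_eq_add_neg, chr_add,
      mul_left_cancel₀ c.ne_zero (key2 x), mul_comm, chr_neg_mul]
  exact dotProduct_eq_zero _ fun w => mem_perp'.1 this w trivial

/-- The two products have the same `Z` and `X` parts, so only the phases from moving an `X` past a
`Z` have to agree. -/
lemma pauli_commute_iff [Finite F] (c c' : ℂˣ) (b a b' a' : Q → F) :
    pauli p c b a * pauli p c' b' a' = pauli p c' b' a' * pauli p c b a ↔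
      chr p (b' ⬝ᵥ a) = chr p (b ⬝ᵥ a') := by
  obtain ⟨u, -, hu⟩ := exists_phase_chr p (-(b' ⬝ᵥ a))
  obtain ⟨v, -, hv⟩ := exists_phase_chr p (-(b ⬝ᵥ a'))
  rw [pauli_mul p c c' u _ _ _ _ hu, pauli_mul p c' c v _ _ _ _ hv, add_comm b', add_comm a',
    mul_comm c']
  have h1 := chr_neg_mul p (b' ⬝ᵥ a)
  have h2 := chr_neg_mul p (b ⬝ᵥ a')
  rw [← hu] at h1
  rw [← hv] at h2
  constructor
  · intro h
    have huv : u = v := mul_left_cancel (pauli_injective p h).1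
    rw [huv] at h1
    exact mul_left_cancel₀ v.ne_zero (h1.trans h2.symm)
  · intro h
    rw [h] at h1
    rw [Units.ext (mul_right_cancel₀ (chr_ne_zero p _) (h1.trans h2.symm))]

/-- The Pauli operators `c Z^b X^a` with `b` and `a` in given subspaces. -/
def pauliSubgroup (B A : Submodule F (Q → F)) : Subgroup (Space F Q ≃ₗ[ℂ] Space F Q) where
  carrier := {U | ∃ c ∈ phases p, ∃ b ∈ B, ∃ a ∈ A, U = pauli p c b a}
  one_mem' := ⟨1, one_mem _, 0, zero_mem _, 0, zero_mem _, by
    rw [pauli_one_zero_left]; ext ψ x; simp⟩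
  mul_mem' := by
    rintro _ _ ⟨c, hc, b, hb, a, ha, rfl⟩ ⟨c', hc', b', hb', a', ha', rfl⟩
    obtain ⟨u, hu, hu'⟩ := exists_phase_chr p (-(b' ⬝ᵥ a))
    exact ⟨c * c' * u, mul_mem (mul_mem hc hc') hu, b + b', add_mem hb hb', a + a',
      add_mem ha ha', pauli_mul p _ _ _ _ _ _ _ hu'⟩
  inv_mem' := by
    rintro _ ⟨c, hc, b, hb, a, ha, rfl⟩
    obtain ⟨u, hu, hu'⟩ := exists_phase_chr p (-(b ⬝ᵥ a))
    refine ⟨c⁻¹ * u, mul_mem (inv_mem hc) hu, -b, neg_mem hb, -a, neg_mem ha, ?_⟩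
    obtain ⟨v, -, hv⟩ := exists_phase_chr p (b ⬝ᵥ a)
    rw [inv_eq_iff_mul_eq_one, pauli_mul p _ _ v _ _ _ _ (by simpa using hv), add_neg_cancel,
      add_neg_cancel, pauli_zero_zero, show c * (c⁻¹ * u) * v = 1 from ?_]
    · ext ψ x; simp
    · rw [mul_inv_cancel_left]
      exact Units.ext (by simp [hu', hv, chr_neg_mul])

lemma pauli_mem_pauliSubgroup [Finite F] {B A : Submodule F (Q → F)} {c : ℂˣ} {b a : Q → F} :
    pauli p c b a ∈ pauliSubgroup p B A ↔ c ∈ phases p ∧ b ∈ B ∧ a ∈ A := by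
  constructor
  · rintro ⟨c', hc, b', hb, a', ha, h⟩
    obtain ⟨rfl, rfl, rfl⟩ := pauli_injective p h
    exact ⟨hc, hb, ha⟩
  · rintro ⟨hc, hb, ha⟩
    exact ⟨c, hc, b, hb, a, ha, rfl⟩

lemma pauliSubgroup_inf [Finite F] (B A B' A' : Submodule F (Q → F)) :
    pauliSubgroup p B A ⊓ pauliSubgroup p B' A' = pauliSubgroup p (B ⊓ B') (A ⊓ A') := by
  refine le_antisymm ?_ ?_
  · rintro _ ⟨⟨c, hc, b, hb, a, ha, rfl⟩, h⟩
    obtain ⟨-, hb', ha'⟩ := (pauli_mem_pauliSubgroup p).1 h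
    exact ⟨c, hc, b, ⟨hb, hb'⟩, a, ⟨ha, ha'⟩, rfl⟩
  · rintro _ ⟨c, hc, b, hb, a, ha, rfl⟩
    exact ⟨⟨c, hc, b, hb.1, a, ha.1, rfl⟩, ⟨c, hc, b, hb.2, a, ha.2, rfl⟩⟩

lemma pauliSubgroup_le_pauliGroup (B A : Submodule F (Q → F)) :
    pauliSubgroup p B A ≤ pauliGroup p F Q := by
  rintro _ ⟨c, hc, b, -, a, -, rfl⟩
  exact ⟨c, hc, b, a, rfl⟩

/-- The centralizer of a group of Pauli operators with `Z` part `B` and `X` part `A`. -/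
lemma pauliCentralizer_eq [Finite F] {B A : Submodule F (Q → F)}
    {T : Subgroup (Space F Q ≃ₗ[ℂ] Space F Q)} (hT : T ≤ pauliSubgroup p B A)
    (hX : ∀ a ∈ A, X a ∈ T) (hZ : ∀ b ∈ B, Z p b ∈ T) :
    pauliCentralizer p T = pauliSubgroup p (perp A) (perp B) := by
  refine le_antisymm ?_ ?_
  · rintro _ ⟨⟨c, hc, b, a, rfl⟩, h⟩
    replace h := Subgroup.mem_centralizer_iff.1 h
    refine ⟨c, hc, b, ?_, a, ?_, rfl⟩
    · rw [mem_perp_iff_chr p]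
      intro w hw
      have := h _ (hX w hw)
      rw [← pauli_one_zero_left p, pauli_commute_iff] at this
      simpa [chr_zero, dotProduct_comm] using this
    · rw [mem_perp_iff_chr p]
      intro w hw
      have := h _ (hZ w hw)
      rw [← pauli_one_zero_right p, pauli_commute_iff] at this
      simpa [chr_zero] using this.symm
  · rintro _ ⟨c, hc, b, hb, a, ha, rfl⟩
    refine ⟨⟨c, hc, b, a, rfl⟩, Subgroup.mem_centralizer_iff.2 ?_⟩
    intro U hU
    obtain ⟨c', hc', b', hb', a', ha', rfl⟩ := hT hU
    rw [pauli_commute_iff, mem_perp'.1 hb a' ha', ha b' hb']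

lemma cssGauge_eq {ρ σ : Type*} (GX : Matrix ρ Q F) (GZ : Matrix σ Q F) :
    cssGauge p GX GZ = pauliSubgroup p (rowSpace GZ) (rowSpace GX) := by
  refine le_antisymm (sup_le ?_ ((Subgroup.closure_le _).2 ?_)) ?_
  · rintro _ ⟨c, hc, rfl⟩
    exact ⟨c, hc, 0, zero_mem _, 0, zero_mem _, (pauli_zero_zero p c).symm⟩
  · rintro _ (⟨a, ha, rfl⟩ | ⟨b, hb, rfl⟩)
    · exact ⟨1, one_mem _, 0, zero_mem _, a, ha, (pauli_one_zero_left p a).symm⟩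
    · exact ⟨1, one_mem _, b, hb, 0, zero_mem _, (pauli_one_zero_right p b).symm⟩
  · rintro _ ⟨c, hc, b, hb, a, ha, rfl⟩
    refine mul_mem (mul_mem (le_sup_left (a := phaseGroup p) ⟨c, hc, rfl⟩) ?_) ?_ <;>
    refine le_sup_right (a := phaseGroup p) (Subgroup.subset_closure ?_)
    · exact Or.inr ⟨b, hb, rfl⟩
    · exact Or.inl ⟨a, ha, rfl⟩

variable [Finite F] (W U : Submodule F (Q → F))

lemma X_mem_pauliSubgroup {a : Q → F} : X a ∈ pauliSubgroup p W U ↔ a ∈ U := by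
  simp [← pauli_one_zero_left p, pauli_mem_pauliSubgroup]

lemma Z_mem_pauliSubgroup {b : Q → F} : Z p b ∈ pauliSubgroup p W U ↔ b ∈ W := by
  simp [← pauli_one_zero_right p, pauli_mem_pauliSubgroup]

lemma pauliCentralizer_pauliSubgroup :
    pauliCentralizer p (pauliSubgroup p W U) = pauliSubgroup p (perp U) (perp W) :=
  pauliCentralizer_eq p le_rfl (fun _ => (X_mem_pauliSubgroup p W U).2)
    fun _ => (Z_mem_pauliSubgroup p W U).2

lemma gaugeCenter_pauliSubgroup :
    gaugeCenter p (pauliSubgroup p W U) = pauliSubgroup p (W ⊓ perp U) (U ⊓ perp W) := by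
  rw [gaugeCenter, pauliCentralizer_pauliSubgroup, pauliSubgroup_inf, inf_comm W, inf_comm U]

/-- The `Z` parts lie in `W` and the `X` parts in `W^⊥`, so reordering a product creates no phase.
This is why the stabilizer group contains no nontrivial scalar. -/
lemma mem_cssStabilizer_iff {V : Space F Q ≃ₗ[ℂ] Space F Q} :
    V ∈ cssStabilizer p (pauliSubgroup p W U) ↔
      ∃ b ∈ W ⊓ perp U, ∃ a ∈ U ⊓ perp W, V = pauli p 1 b a := by
  rw [cssStabilizer, gaugeCenter_pauliSubgroup]
  constructor
  · intro h
    induction h using Subgroup.closure_induction with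
    | mem V hV =>
      obtain ⟨⟨a, rfl⟩ | ⟨b, rfl⟩, h⟩ := hV
      · exact ⟨0, zero_mem _, a, (X_mem_pauliSubgroup p _ _).1 h, (pauli_one_zero_left p a).symm⟩
      · exact ⟨b, (Z_mem_pauliSubgroup p _ _).1 h, 0, zero_mem _, (pauli_one_zero_right p b).symm⟩
    | one =>
      exact ⟨0, zero_mem _, 0, zero_mem _, by rw [pauli_one_zero_left]; ext ψ x; simp⟩
    | mul V V' _ _ h h' =>
      obtain ⟨b, hb, a, ha, rfl⟩ := h
      obtain ⟨b', hb', a', ha', rfl⟩ := h'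
      refine ⟨b + b', add_mem hb hb', a + a', add_mem ha ha', ?_⟩
      rw [pauli_mul_of_dotProduct p _ _ _ _ _ _ (ha.2 b' hb'.1), mul_one]
    | inv V _ h =>
      obtain ⟨b, hb, a, ha, rfl⟩ := h
      refine ⟨-b, neg_mem hb, -a, neg_mem ha, ?_⟩
      rw [inv_eq_iff_mul_eq_one, pauli_mul_of_dotProduct p _ _ _ _ _ _ (by simp [ha.2 b hb.1]),
        add_neg_cancel, add_neg_cancel, mul_one, pauli_one_zero_left]
      ext ψ x; simp
  · rintro ⟨b, hb, a, ha, rfl⟩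
    rw [show pauli p 1 b a = Z p b * X a by ext ψ x; simp [pauli_apply]]
    exact mul_mem
      (Subgroup.subset_closure ⟨Or.inr ⟨b, rfl⟩, (Z_mem_pauliSubgroup p _ _).2 hb⟩)
      (Subgroup.subset_closure ⟨Or.inl ⟨a, rfl⟩, (X_mem_pauliSubgroup p _ _).2 ha⟩)

lemma X_mem_cssStabilizer {a : Q → F} (ha : a ∈ U ⊓ perp W) :
    X a ∈ cssStabilizer p (pauliSubgroup p W U) :=
  (mem_cssStabilizer_iff p W U).2 ⟨0, zero_mem _, a, ha, (pauli_one_zero_left p a).symm⟩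

lemma Z_mem_cssStabilizer {b : Q → F} (hb : b ∈ W ⊓ perp U) :
    Z p b ∈ cssStabilizer p (pauliSubgroup p W U) :=
  (mem_cssStabilizer_iff p W U).2 ⟨b, hb, 0, zero_mem _, (pauli_one_zero_right p b).symm⟩

lemma pauliCentralizer_cssStabilizer :
    pauliCentralizer p (cssStabilizer p (pauliSubgroup p W U)) =
      pauliSubgroup p (perp U ⊔ W) (perp W ⊔ U) := by
  -- The stabilizer group lacks the phases, so it is not itself a `pauliSubgroup`; phases do not
  -- affect centralizers.
  rw [pauliCentralizer_eq p (B := W ⊓ perp U) (A := U ⊓ perp W) ?_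
    (fun _ => X_mem_cssStabilizer p W U) (fun _ => Z_mem_cssStabilizer p W U), perp_inf, perp_inf,
    perp_perp, perp_perp]
  intro V hV
  obtain ⟨b, hb, a, ha, rfl⟩ := (mem_cssStabilizer_iff p W U).1 hV
  exact ⟨1, one_mem _, b, hb, a, ha, rfl⟩

lemma isStabilizerOf_cssStabilizer :
    IsStabilizerOf p (pauliSubgroup p W U) (cssStabilizer p (pauliSubgroup p W U)) where
  sup_phases := by
    rw [gaugeCenter_pauliSubgroup]
    refine le_antisymm (sup_le ?_ ?_) ?_
    · intro V hV
      obtain ⟨b, hb, a, ha, rfl⟩ := (mem_cssStabilizer_iff p W U).1 hV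
      exact ⟨1, one_mem _, b, hb, a, ha, rfl⟩
    · rintro _ ⟨c, hc, rfl⟩
      exact ⟨c, hc, 0, zero_mem _, 0, zero_mem _, (pauli_zero_zero p c).symm⟩
    · rintro _ ⟨c, hc, b, hb, a, ha, rfl⟩
      rw [show pauli p c b a = pauli p 1 b a * phase c by
        ext ψ x; simp only [pauli_apply, LinearEquiv.mul_apply, phase_apply, Units.val_one]; ring]
      exact Subgroup.mul_mem_sup ((mem_cssStabilizer_iff p W U).2 ⟨b, hb, a, ha, rfl⟩)
        ⟨c, hc, rfl⟩
  inf_phases := by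
    rw [eq_bot_iff]
    rintro _ ⟨h, c, -, rfl⟩
    obtain ⟨b, -, a, -, h⟩ := (mem_cssStabilizer_iff p W U).1 h
    rw [← pauli_zero_zero p] at h
    rw [(pauli_injective p h).1, Subgroup.mem_bot]
    ext ψ x; simp

end Pauli

/-! ### The code space as logical and gauge qudits -/

section Encoding

variable {F : Type*} [Field F] {Q : Type*}

/-- The map `γ` restricts to an isomorphism onto a complement of `B` in `W`. -/
structure IsComplementMap {V m : Type*} [AddCommGroup V] [Module F V]
    (γ : (m → F) →ₗ[F] V) (B W : Submodule F V) : Prop where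
  mem : ∀ c, γ c ∈ W
  eq_zero : ∀ c, γ c ∈ B → c = 0
  exists_sub_mem : ∀ w ∈ W, ∃ c, w - γ c ∈ B

lemma exists_isComplementMap {V : Type*} [AddCommGroup V] [Module F V] [FiniteDimensional F V]
    {B W : Submodule F V} (h : B ≤ W) :
    ∃ (g : ℕ) (γ : (Fin g → F) →ₗ[F] V), IsComplementMap γ B W := by
  obtain ⟨C, hC⟩ := exists_isCompl B
  let e := (Module.finBasis F ↥(C ⊓ W)).equivFun.symm
  refine ⟨_, (C ⊓ W).subtype ∘ₗ e.toLinearMap, fun c => (e c).2.2, fun c hc => ?_, fun w hw => ?_⟩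
  · have : e c = 0 := Subtype.ext ((Submodule.disjoint_def.1 hC.disjoint) _ hc (e c).2.1)
    simpa using this
  · obtain ⟨b, hb, c, hc, rfl⟩ := Submodule.mem_sup.1 (hC.sup_eq_top ▸ Submodule.mem_top (x := w))
    have hcW : c ∈ W := by simpa using sub_mem hw (h hb)
    refine ⟨e.symm ⟨c, hc, hcW⟩, ?_⟩
    simpa using hb

lemma IsComplementMap.comp_equiv {V m m' : Type*} [AddCommGroup V] [Module F V]
    {γ : (m → F) →ₗ[F] V} {B W : Submodule F V} (h : IsComplementMap γ B W) (e : m' ≃ m) :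
    IsComplementMap (γ ∘ₗ (LinearEquiv.funCongrLeft F F e.symm).toLinearMap) B W where
  mem c := h.mem _
  eq_zero c hc := (LinearEquiv.map_eq_zero_iff _).1 (h.eq_zero _ hc)
  exists_sub_mem w hw := by
    obtain ⟨c, hc⟩ := h.exists_sub_mem w hw
    refine ⟨(LinearEquiv.funCongrLeft F F e.symm).symm c, ?_⟩
    rwa [LinearMap.comp_apply, LinearEquiv.coe_coe, LinearEquiv.apply_symm_apply]

section Pullback

open scoped Classical in
/-- The state with amplitude `s * ψ (θ x)` at `x ∈ D` and zero elsewhere. -/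
def pullback {m : Type*} (D : Submodule F (Q → F)) (θ : (Q → F) →ₗ[F] (m → F)) (s : ℂ) :
    Space F m →ₗ[ℂ] Space F Q where
  toFun ψ := WithLp.toLp 2 fun x => if x ∈ D then s * ψ (θ x) else 0
  map_add' ψ φ := by ext x; by_cases h : x ∈ D <;> simp [h, mul_add]
  map_smul' c ψ := by ext x; by_cases h : x ∈ D <;> simp [h, mul_left_comm]

variable {m : Type*} (D : Submodule F (Q → F)) (θ : (Q → F) →ₗ[F] (m → F)) (s : ℂ)

lemma pullback_apply_of_mem (ψ : Space F m) {x : Q → F} (hx : x ∈ D) :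
    pullback D θ s ψ x = s * ψ (θ x) := if_pos hx

lemma pullback_apply_of_notMem (ψ : Space F m) {x : Q → F} (hx : x ∉ D) :
    pullback D θ s ψ x = 0 := if_neg hx

/-- The fibres of `θ` on `D` are cosets of `D ∩ ker θ`, so each amplitude of `ψ` is repeated equally
often; `s` compensates for this. -/
lemma norm_pullback [Fintype Q] [DecidableEq Q] [Fintype m] [DecidableEq m] [Fintype F] (hθ : ∀ y, ∃ x ∈ D, θ x = y)
    (hs : Nat.card ↥(D ⊓ LinearMap.ker θ) * ‖s‖ ^ 2 = 1) (ψ : Space F m) :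
    ‖pullback D θ s ψ‖ = ‖ψ‖ := by
  classical
  rw [EuclideanSpace.norm_eq, EuclideanSpace.norm_eq]
  congr 1
  have h1 (x : Q → F) : ‖pullback D θ s ψ x‖ ^ 2 =
      if x ∈ D then ‖s‖ ^ 2 * ‖ψ (θ x)‖ ^ 2 else 0 := by
    by_cases hx : x ∈ D
    · rw [pullback_apply_of_mem D θ s ψ hx, if_pos hx, norm_mul, mul_pow]
    · rw [pullback_apply_of_notMem D θ s ψ hx, if_neg hx, norm_zero]; simp
  simp only [h1]
  rw [← Finset.sum_filter, ← Finset.sum_fiberwise _ θ]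
  refine Finset.sum_congr rfl fun y _ => ?_
  rw [Finset.sum_congr rfl (g := fun _ => ‖s‖ ^ 2 * ‖ψ y‖ ^ 2)
    fun x hx => by rw [(Finset.mem_filter.1 hx).2], Finset.sum_const, nsmul_eq_mul, ← mul_assoc]
  obtain ⟨x₀, hx₀, rfl⟩ := hθ y
  have hcard : Nat.card ↥(D ⊓ LinearMap.ker θ) =
      ((Finset.univ.filter (· ∈ D)).filter (θ · = θ x₀)).card := by
    rw [Nat.subtype_card (p := (· ∈ D ⊓ LinearMap.ker θ)) (Finset.univ.filter (· ∈ D ⊓ LinearMap.ker θ))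
      (by simp)]
    refine Finset.card_bij' (fun x _ => x + x₀) (fun x _ => x - x₀) ?_ ?_ (by simp) (by simp)
    · intro x hx
      obtain ⟨hx, hx'⟩ := (Finset.mem_filter.1 hx).2
      simp [D.add_mem hx hx₀, LinearMap.mem_ker.1 hx']
    · intro x hx
      simp only [Finset.mem_filter, Finset.mem_univ, true_and] at hx
      simp [D.sub_mem hx.1 hx₀, hx.2]
  rw [← hcard, hs, one_mul]

end Pullback

variable [Fintype Q]

/-- The transpose of a linear map `F^m → F^Q`. -/
def transposeMap {m : Type*} [DecidableEq m] (γ : (m → F) →ₗ[F] (Q → F)) :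
    (Q → F) →ₗ[F] (m → F) where
  toFun x i := γ (Pi.single i 1) ⬝ᵥ x
  map_add' x y := by ext i; simp
  map_smul' c x := by ext i; simp

lemma dotProduct_transposeMap {m : Type*} [Fintype m] [DecidableEq m]
    (γ : (m → F) →ₗ[F] (Q → F)) (c : m → F) (x : Q → F) :
    c ⬝ᵥ transposeMap γ x = γ c ⬝ᵥ x := by
  conv_rhs => rw [pi_eq_sum_univ' c]
  simp [dotProduct, transposeMap, map_sum, Finset.sum_mul, Finset.mul_sum, mul_assoc]
  exact Finset.sum_comm

variable (p : ℕ) [Fact p.Prime] [Algebra (ZMod p) F]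

/-- The `Z` stabilizers restrict the support, since an amplitude multiplied by a character value
other than `1` must vanish; the `X` stabilizers impose the translation invariance. -/
lemma mem_codeSpace_cssStabilizer [Finite F] (W U : Submodule F (Q → F)) (ψ : Space F Q) :
    ψ ∈ codeSpace (cssStabilizer p (pauliSubgroup p W U)) ↔
      (∀ x ∉ perp (W ⊓ perp U), ψ x = 0) ∧ ∀ a ∈ U ⊓ perp W, ∀ x, ψ (x - a) = ψ x := by
  constructor
  · refine fun h => ⟨fun x hx => ?_, fun a ha x => ?_⟩
    · rw [mem_perp_iff_chr p] at hx
      push Not at hx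
      obtain ⟨b, hb, hx⟩ := hx
      have := congrArg (fun φ : Space F Q => φ x) (h _ (Z_mem_cssStabilizer p W U hb))
      simp only [Z_apply] at this
      by_contra h0
      exact hx (mul_right_cancel₀ h0 (this.trans (one_mul _).symm))
    · exact congrArg (fun φ : Space F Q => φ x) (h _ (X_mem_cssStabilizer p W U ha))
  · rintro ⟨h, h'⟩ V hV
    obtain ⟨b, hb, a, ha, rfl⟩ := (mem_cssStabilizer_iff p W U).1 hV
    ext x
    rw [pauli_apply, h' a ha, Units.val_one, one_mul]
    by_cases hx : x ∈ perp (W ⊓ perp U)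
    · rw [hx b hb, chr_zero, one_mul]
    · rw [h x hx, mul_zero]

section Encodes

variable (W U : Submodule F (Q → F))

lemma mem_perp_inf_of_mem {a : Q → F} (ha : a ∈ U) : a ∈ perp (W ⊓ perp U) :=
  fun _ hb => mem_perp'.1 hb.2 a ha

lemma mem_perp_inf_of_mem_perp {a : Q → F} (ha : a ∈ perp W) : a ∈ perp (W ⊓ perp U) :=
  fun b hb => ha b hb.1

/-- On `D = B^⊥` the operators `Z^b` and `Z^(γ c)` agree, and transposing `γ` turns the latter into
`Z^c`. A shift by `a ∈ D` preserves `D` and becomes a shift by the image of `a`. -/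
lemma pauli_pullback {m : Type*} [Fintype m] [DecidableEq m] (γ : (m → F) →ₗ[F] (Q → F)) (s : ℂ)
    {D B : Submodule F (Q → F)} (hD : D = perp B) {b a : Q → F} (c : m → F) (hb : b - γ c ∈ B)
    (ha : a ∈ D) (t : ℂˣ) (ψ : Space F m) :
    pauli p t b a (pullback D (transposeMap γ) s ψ) =
      pullback D (transposeMap γ) s (pauli p t c (transposeMap γ a) ψ) := by
  ext x
  by_cases hx : x ∈ D
  · have h : b ⬝ᵥ x = γ c ⬝ᵥ x := by
      rw [← sub_eq_zero, ← sub_dotProduct]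
      exact (hD ▸ hx) _ hb
    rw [pauli_apply, pullback_apply_of_mem _ _ _ _ hx, pullback_apply_of_mem _ _ _ _ (sub_mem hx ha),
      pauli_apply, dotProduct_transposeMap, h, map_sub]
    ring
  · have hxa : x - a ∉ D := fun h => hx (by simpa using add_mem h ha)
    rw [pauli_apply, pullback_apply_of_notMem _ _ _ _ hx, pullback_apply_of_notMem _ _ _ _ hxa,
      mul_zero, mul_zero]

/-- The transpose `θ` of the two complement maps together identifies `D / (U ∩ W^⊥)` with `F^k ×
F^g`; the encoding is composition with `θ`, normalized. -/
lemma exists_encodes [Fintype F] [DecidableEq Q] {k : ℕ} {lam : (Fin k → F) →ₗ[F] (Q → F)}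
    (hlam : IsComplementMap lam (W ⊓ perp U) (perp U)) :
    ∃ g, Encodes p (pauliSubgroup p W U) (cssStabilizer p (pauliSubgroup p W U)) k g := by
  obtain ⟨g, bet, hbet⟩ := exists_isComplementMap (inf_le_left : W ⊓ perp U ≤ W)
  refine ⟨g, ?_⟩
  set D := perp (W ⊓ perp U) with hD
  let γ : (Fin k ⊕ Fin g → F) →ₗ[F] (Q → F) :=
    lam ∘ₗ LinearMap.funLeft F F Sum.inl + bet ∘ₗ LinearMap.funLeft F F Sum.inr
  have hγl (c : Fin k → F) : γ (Sum.elim c 0) = lam c := by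
    change lam c + bet 0 = _
    rw [map_zero, add_zero]
  have hγr (c : Fin g → F) : γ (Sum.elim 0 c) = bet c := by
    change lam 0 + bet c = _
    rw [map_zero, zero_add]
  set θ := transposeMap γ with hθ
  have hθ_elim (x : Q → F) : θ x = Sum.elim (transposeMap lam x) (transposeMap bet x) := by
    refine sub_eq_zero.1 (dotProduct_eq_zero _ fun c => ?_)
    obtain ⟨c₁, c₂, rfl⟩ : ∃ c₁ c₂, c = Sum.elim c₁ c₂ := ⟨_, _, (Sum.elim_comp_inl_inr c).symm⟩
    rw [dotProduct_comm, dotProduct_sub, sub_eq_zero, dotProduct_transposeMap,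
      sumElim_dotProduct_sumElim, dotProduct_transposeMap, dotProduct_transposeMap,
      ← add_dotProduct]
    rfl
  -- `lam` takes values in `U^⊥`, so gauge shifts leave the logical coordinates fixed; dually, `bet`
  -- takes values in `W`.
  have hθU {a : Q → F} (ha : a ∈ U) : θ a = Sum.elim (0 : Fin k → F) (transposeMap bet a) := by
    suffices h : transposeMap lam a = 0 by rw [hθ_elim, h]
    refine dotProduct_eq_zero _ fun c => ?_
    rw [dotProduct_comm, dotProduct_transposeMap]
    exact mem_perp'.1 (hlam.mem c) a ha
  have hθW {a : Q → F} (ha : a ∈ perp W) : θ a = Sum.elim (transposeMap lam a) 0 := by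
    suffices h : transposeMap bet a = 0 by rw [hθ_elim, h]
    refine dotProduct_eq_zero _ fun c => ?_
    rw [dotProduct_comm, dotProduct_transposeMap]
    exact ha _ (hbet.mem c)
  -- A functional `c` that vanishes on the image puts `bet c` in `W ∩ U^⊥`, which forces `c = 0`.
  have hsurjU (y : Fin g → F) : ∃ a ∈ U, transposeMap bet a = y := by
    refine exists_mem_eq_of_dotProduct _ _ (fun c hc => hbet.eq_zero c ⟨hbet.mem c, ?_⟩) y
    simpa only [SetLike.mem_coe, mem_perp' (x := bet c), dotProduct_transposeMap] using hc
  have hsurjW (y : Fin k → F) : ∃ a ∈ perp W, transposeMap lam a = y := by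
    refine exists_mem_eq_of_dotProduct _ _ (fun c hc => hlam.eq_zero c ⟨?_, hlam.mem c⟩) y
    rw [← perp_perp W]
    simpa only [SetLike.mem_coe, mem_perp' (x := lam c), dotProduct_transposeMap] using hc
  have hsurj (y : Fin k ⊕ Fin g → F) : ∃ x ∈ D, θ x = y := by
    obtain ⟨a, ha, h⟩ := hsurjW (y ∘ Sum.inl)
    obtain ⟨a', ha', h'⟩ := hsurjU (y ∘ Sum.inr)
    refine ⟨a + a', add_mem (mem_perp_inf_of_mem_perp W U ha) (mem_perp_inf_of_mem W U ha'), ?_⟩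
    rw [map_add, hθW ha, hθU ha', h, h']
    ext (i | i) <;> simp
  -- `U^⊥` and `W` are `W ∩ U^⊥` plus the images of `lam` and `bet`. A vector of `D` killed by `θ`
  -- is orthogonal to all three pieces.
  have hker : D ⊓ LinearMap.ker θ = U ⊓ perp W := by
    refine le_antisymm ?_ ?_
    · rintro x ⟨hx, hx0⟩
      have hx0 (c) : γ c ⬝ᵥ x = 0 := by
        rw [← dotProduct_transposeMap, ← hθ, LinearMap.mem_ker.1 hx0, dotProduct_zero]
      constructor
      · rw [SetLike.mem_coe, ← perp_perp U]
        intro w hw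
        obtain ⟨c, hc⟩ := hlam.exists_sub_mem w hw
        rw [← sub_add_cancel w (lam c), add_dotProduct, hx _ hc, ← hγl, hx0, add_zero]
      · intro w hw
        obtain ⟨c, hc⟩ := hbet.exists_sub_mem w hw
        rw [← sub_add_cancel w (bet c), add_dotProduct, hx _ hc, ← hγr, hx0, add_zero]
    · rintro x ⟨hxU, hxW⟩
      refine ⟨mem_perp_inf_of_mem W U hxU, LinearMap.mem_ker.2 ?_⟩
      have h := congrArg (· ∘ Sum.inr) ((hθU hxU).symm.trans (hθW hxW))
      rw [hθU hxU, show transposeMap bet x = 0 from h, Sum.elim_zero_zero]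
  set N := Nat.card ↥(D ⊓ LinearMap.ker θ)
  have hN0 : (0 : ℝ) < N := Nat.cast_pos.2 Nat.card_pos
  let s : ℂ := ((√N)⁻¹ : ℝ)
  have hs : N * ‖s‖ ^ 2 = 1 := by
    rw [Complex.norm_real, Real.norm_eq_abs, sq_abs, inv_pow, Real.sq_sqrt hN0.le,
      mul_inv_cancel₀ hN0.ne']
  have hs0 : s ≠ 0 := by rintro h; simp [h] at hs
  let E : Space F (Fin k ⊕ Fin g) →ₗᵢ[ℂ] codeSpace (cssStabilizer p (pauliSubgroup p W U)) :=
    { toLinearMap := (pullback D θ s).codRestrict _ fun ψ => by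
        refine (mem_codeSpace_cssStabilizer p W U _).2
          ⟨fun x hx => pullback_apply_of_notMem _ _ _ _ hx, fun a ha x => ?_⟩
        obtain ⟨haD, hak⟩ := hker ▸ ha
        by_cases hx : x ∈ D
        · rw [pullback_apply_of_mem _ _ _ _ hx, pullback_apply_of_mem _ _ _ _ (sub_mem hx haD),
            map_sub, LinearMap.mem_ker.1 hak, sub_zero]
        · have hxa : x - a ∉ D := fun h => hx (by simpa using add_mem h haD)
          rw [pullback_apply_of_notMem _ _ _ _ hx, pullback_apply_of_notMem _ _ _ _ hxa]
      norm_map' := norm_pullback D θ s hsurj hs }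
  -- By `hker`, a code state is constant on the fibres of `θ` in `D`, so its values on a section `f`
  -- of `θ` determine it.
  have hE : Function.Surjective E := by
    rintro ⟨φ, hφ⟩
    obtain ⟨hφ0, hφa⟩ := (mem_codeSpace_cssStabilizer p W U _).1 hφ
    choose f hfD hf using id hsurj
    refine ⟨WithLp.toLp 2 fun y => s⁻¹ * φ (f y), Subtype.ext ?_⟩
    ext x
    change pullback D θ s _ x = φ x
    by_cases hx : x ∈ D
    · rw [pullback_apply_of_mem _ _ _ _ hx, mul_inv_cancel_left₀ hs0]
      have hmem : x - f (θ x) ∈ U ⊓ perp W := by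
        rw [← hker]
        exact ⟨sub_mem hx (hfD _), by simp [hf]⟩
      simpa using hφa _ hmem x
    · rw [pullback_apply_of_notMem _ _ _ _ hx, hφ0 x hx]
  refine ⟨LinearIsometryEquiv.ofSurjective E hE, ?_, ?_, ?_, ?_⟩
  · rintro _ ⟨t, ht, b, hb, a, ha, rfl⟩
    obtain ⟨c, hc⟩ := hbet.exists_sub_mem b hb
    refine ⟨t, ht, c, transposeMap bet a, fun ψ => ?_⟩
    rw [← hθU ha]
    exact pauli_pullback p γ s hD _ (by rwa [hγr]) (mem_perp_inf_of_mem W U ha) t ψ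
  · intro t ht c α
    obtain ⟨a, ha, rfl⟩ := hsurjU α
    refine ⟨_, ⟨t, ht, bet c, hbet.mem c, a, ha, rfl⟩, fun ψ => ?_⟩
    rw [← hθU ha]
    exact pauli_pullback p γ s hD _ (by simp [hγr]) (mem_perp_inf_of_mem W U ha) t ψ
  · rw [pauliCentralizer_pauliSubgroup]
    rintro _ ⟨t, ht, b, hb, a, ha, rfl⟩
    obtain ⟨c, hc⟩ := hlam.exists_sub_mem b hb
    refine ⟨t, ht, c, transposeMap lam a, fun ψ => ?_⟩
    rw [← hθW ha]
    exact pauli_pullback p γ s hD _ (by rwa [hγl]) (mem_perp_inf_of_mem_perp W U ha) t ψ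
  · rw [pauliCentralizer_pauliSubgroup]
    intro t ht c α
    obtain ⟨a, ha, rfl⟩ := hsurjW α
    refine ⟨_, ⟨t, ht, lam c, hlam.mem c, a, ha, rfl⟩, fun ψ => ?_⟩
    rw [← hθW ha]
    exact pauli_pullback p γ s hD _ (by simp [hγl]) (mem_perp_inf_of_mem_perp W U ha) t ψ

end Encodes

end Encoding

/-! ### The subsystem hypergraph product in terms of matrices -/

section Product

variable {F : Type*} [Field F] {ι κ ρ : Type*}

lemma mem_rowSpace_iff [Fintype ρ] (A : Matrix ρ ι F) (c : ι → F) :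
    c ∈ rowSpace A ↔ ∃ u, Matrix.vecMul u A = c := by
  change c ∈ Submodule.span F (Set.range A.row) ↔ _
  rw [← range_vecMulLinear]
  rfl

variable [Fintype ι] [DecidableEq ι]

lemma one_kronecker_mulVec (A : Matrix κ ι F) (x : ι × ι → F) (i : ι) (k : κ) :
    ((1 : Matrix ι ι F) ⊗ₖ A).mulVec x (i, k) = A.mulVec (fun j => x (i, j)) k := by
  simp [Matrix.mulVec, dotProduct, Fintype.sum_prod_type, Matrix.one_apply, ite_mul,
    Finset.sum_ite_irrel]

lemma kronecker_one_mulVec (A : Matrix κ ι F) (x : ι × ι → F) (j : ι) (k : κ) :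
    (A ⊗ₖ (1 : Matrix ι ι F)).mulVec x (k, j) = A.mulVec (fun i => x (i, j)) k := by
  simp [Matrix.mulVec, dotProduct, Fintype.sum_prod_type, Matrix.one_apply]

variable {G : Matrix ρ ι F} {H : Matrix κ ι F} (hH : IsParityCheck H (rowSpace G))
include hH

lemma mem_perp_rowSpace_one_kronecker (x : ι × ι → F) :
    x ∈ perp (rowSpace ((1 : Matrix ι ι F) ⊗ₖ H)) ↔ ∀ i, (fun j => x (i, j)) ∈ rowSpace G := by
  simp only [mem_perp_rowSpace, hH _, funext_iff, Prod.forall, one_kronecker_mulVec, Pi.zero_apply]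

lemma mem_perp_rowSpace_kronecker_one (x : ι × ι → F) :
    x ∈ perp (rowSpace (H ⊗ₖ (1 : Matrix ι ι F))) ↔ ∀ j, (fun i => x (i, j)) ∈ rowSpace G := by
  simp only [mem_perp_rowSpace, hH _, funext_iff, Prod.forall, kronecker_one_mulVec, Pi.zero_apply]
  exact forall_comm

/-- By double orthogonality it suffices to test against arrays with all rows in the code; those with
a single nonzero row suffice. -/
lemma mem_rowSpace_one_kronecker (x : ι × ι → F) :
    x ∈ rowSpace ((1 : Matrix ι ι F) ⊗ₖ H) ↔ ∀ i, G.mulVec (fun j => x (i, j)) = 0 := by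
  simp only [← mem_perp_rowSpace]
  rw [← perp_perp (rowSpace ((1 : Matrix ι ι F) ⊗ₖ H))]
  constructor
  · intro h i c hc
    have := h (fun ij => if ij.1 = i then c ij.2 else 0)
      ((mem_perp_rowSpace_one_kronecker hH _).2 fun i' => ?_)
    · simpa [dotProduct, Fintype.sum_prod_type, Finset.sum_ite_irrel] using this
    · by_cases h' : i' = i
      · simpa [h'] using hc
      · simp only [h', if_false]
        exact zero_mem (rowSpace G)
  · intro h w hw
    rw [dotProduct, Fintype.sum_prod_type]
    exact Finset.sum_eq_zero fun i _ =>
      h i _ ((mem_perp_rowSpace_one_kronecker hH _).1 hw i)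

lemma mem_rowSpace_kronecker_one (x : ι × ι → F) :
    x ∈ rowSpace (H ⊗ₖ (1 : Matrix ι ι F)) ↔ ∀ j, G.mulVec (fun i => x (i, j)) = 0 := by
  simp only [← mem_perp_rowSpace]
  rw [← perp_perp (rowSpace (H ⊗ₖ (1 : Matrix ι ι F)))]
  constructor
  · intro h j c hc
    have := h (fun ij => if ij.2 = j then c ij.1 else 0)
      ((mem_perp_rowSpace_kronecker_one hH _).2 fun j' => ?_)
    · simpa [dotProduct, Fintype.sum_prod_type] using this
    · by_cases h' : j' = j
      · simpa [h'] using hc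
      · simp only [h', if_false]
        exact zero_mem (rowSpace G)
  · intro h w hw
    rw [dotProduct, Fintype.sum_prod_type_right]
    exact Finset.sum_eq_zero fun j _ =>
      h j _ ((mem_perp_rowSpace_kronecker_one hH _).1 hw j)

/-- If `G` has full rank, then the bare logical `Z` operators modulo the stabilizers are
parametrized by the square matrices. -/
lemma exists_isComplementMap_logical [Fintype ρ] [DecidableEq ρ] {P : Matrix ι ρ F}
    (hP : G * P = 1) :
    ∃ γ : (ρ × ρ → F) →ₗ[F] (ι × ι → F), IsComplementMap γ
      (rowSpace ((1 : Matrix ι ι F) ⊗ₖ H) ⊓ perp (rowSpace (H ⊗ₖ (1 : Matrix ι ι F))))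
      (perp (rowSpace (H ⊗ₖ (1 : Matrix ι ι F)))) := by
  have hP' : P.transpose * G.transpose = 1 := by
    rw [← Matrix.transpose_mul, hP, Matrix.transpose_one]
  have hW (M : Matrix ι ι F) :
      (fun ij : ι × ι => M ij.1 ij.2) ∈ rowSpace ((1 : Matrix ι ι F) ⊗ₖ H) ↔
        M * G.transpose = 0 := by
    rw [mem_rowSpace_one_kronecker hH, ← Matrix.ext_iff]
    simp only [funext_iff, Matrix.mulVec, dotProduct, Matrix.mul_apply, Matrix.transpose_apply,
      mul_comm, Pi.zero_apply, Matrix.zero_apply]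
  have hU (M : Matrix ι ι F) :
      (fun ij : ι × ι => M ij.1 ij.2) ∈ perp (rowSpace (H ⊗ₖ (1 : Matrix ι ι F))) ↔
        ∃ Y : Matrix ρ ι F, G.transpose * Y = M := by
    rw [mem_perp_rowSpace_kronecker_one hH]
    simp only [mem_rowSpace_iff]
    constructor
    · intro h
      choose Y hY using h
      refine ⟨(Matrix.of Y).transpose, ?_⟩
      ext i j
      rw [← congrFun (hY j) i]
      simp [Matrix.mul_apply, Matrix.vecMul, dotProduct, mul_comm]
    · rintro ⟨Y, rfl⟩ j
      refine ⟨fun s => Y s j, ?_⟩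
      ext i
      simp [Matrix.mul_apply, Matrix.vecMul, dotProduct, mul_comm]
  -- The witness is `C ↦ Gᵀ C Pᵀ`: the factor `Gᵀ` puts the columns in the code, and `Pᵀ Gᵀ = 1`
  -- makes `C` recoverable after right multiplication by `Gᵀ`, the map with kernel `W`.
  let γ : (ρ × ρ → F) →ₗ[F] (ι × ι → F) :=
    { toFun c ij := (G.transpose * (Matrix.of fun s t => c (s, t)) * P.transpose) ij.1 ij.2
      map_add' c d := by
        have : (Matrix.of fun s t => (c + d) (s, t)) =
          (Matrix.of fun s t => c (s, t)) + (Matrix.of fun s t => d (s, t)) := rfl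
        simp only [this, Matrix.mul_add, Matrix.add_mul]
        rfl
      map_smul' a c := by
        have : (Matrix.of fun s t => (a • c) (s, t)) = a • (Matrix.of fun s t => c (s, t)) := rfl
        simp only [this, Matrix.mul_smul, Matrix.smul_mul]
        rfl }
  have hγ (c : ρ × ρ → F) : γ c ∈ perp (rowSpace (H ⊗ₖ (1 : Matrix ι ι F))) :=
    (hU _).2 ⟨_, (Matrix.mul_assoc _ _ _).symm⟩
  refine ⟨γ, hγ, fun c hc => ?_, fun x hx => ?_⟩
  · have h := (hW (G.transpose * (Matrix.of fun s t => c (s, t)) * P.transpose)).1 hc.1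
    rw [Matrix.mul_assoc, hP', Matrix.mul_one] at h
    have h' := congrArg (P.transpose * ·) h
    simp only [← Matrix.mul_assoc, hP', Matrix.one_mul, Matrix.mul_zero] at h'
    ext ⟨s, t⟩
    exact congrFun (congrFun h' s) t
  · obtain ⟨Y, hY⟩ := (hU (Matrix.of fun i j => x (i, j))).1 hx
    -- With `x = Gᵀ Y`, the choice `C = Y Gᵀ` makes `x` and `γ C` agree after right multiplication
    -- by `Gᵀ`.
    refine ⟨fun st => (Y * G.transpose) st.1 st.2, ?_, sub_mem hx (hγ _)⟩
    refine (hW (Matrix.of (fun i j => x (i, j)) - G.transpose * (Y * G.transpose) *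
      P.transpose)).2 ?_
    rw [← hY, Matrix.sub_mul, Matrix.mul_assoc _ P.transpose, hP', Matrix.mul_one,
      Matrix.mul_assoc, sub_self]

/-- A dressed logical `X` operator combines the rows to a nonzero codeword. -/
lemma exists_codeword_of_columns {a : ι × ι → F}
    (ha : a ∈ perp (rowSpace ((1 : Matrix ι ι F) ⊗ₖ H)) ⊔ rowSpace (H ⊗ₖ (1 : Matrix ι ι F)))
    (ha' : a ∉ rowSpace (H ⊗ₖ (1 : Matrix ι ι F))) :
    ∃ v ∈ rowSpace G, v ≠ 0 ∧ ∀ j, v j ≠ 0 → ∃ i, a (i, j) ≠ 0 := by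
  obtain ⟨y, hy, z, hz, rfl⟩ := Submodule.mem_sup.1 ha
  rw [mem_perp_rowSpace_one_kronecker hH] at hy
  rw [mem_rowSpace_kronecker_one hH] at hz ha'
  simp only [funext_iff, not_forall] at ha'
  obtain ⟨j, s, h⟩ := ha'
  -- Row `s` of `G` gives the coefficients. It annihilates the columns of the gauge part `z`,
  -- leaving a combination of the rows of `y`, which are codewords.
  refine ⟨fun j => G.mulVec (fun i => (y + z) (i, j)) s, ?_, fun h0 => h (congrFun h0 j), ?_⟩
  · convert (rowSpace G).sum_mem fun i (_ : i ∈ Finset.univ) =>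
      (rowSpace G).smul_mem (G s i) (hy i)
    rename_i j
    have h1 := congrFun (hz j) s
    simp only [Matrix.mulVec, dotProduct, Pi.zero_apply] at h1
    simp [Matrix.mulVec, dotProduct, mul_add, Finset.sum_add_distrib, h1]
  · intro j hj
    by_contra! h0
    exact hj (by simp only [Matrix.mulVec, dotProduct, h0, mul_zero, Finset.sum_const_zero])

/-- A dressed logical `Z` operator combines the columns to a nonzero codeword. -/
lemma exists_codeword_of_rows {b : ι × ι → F}
    (hb : b ∈ perp (rowSpace (H ⊗ₖ (1 : Matrix ι ι F))) ⊔ rowSpace ((1 : Matrix ι ι F) ⊗ₖ H))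
    (hb' : b ∉ rowSpace ((1 : Matrix ι ι F) ⊗ₖ H)) :
    ∃ v ∈ rowSpace G, v ≠ 0 ∧ ∀ i, v i ≠ 0 → ∃ j, b (i, j) ≠ 0 := by
  obtain ⟨y, hy, z, hz, rfl⟩ := Submodule.mem_sup.1 hb
  rw [mem_perp_rowSpace_kronecker_one hH] at hy
  rw [mem_rowSpace_one_kronecker hH] at hz hb'
  simp only [funext_iff, not_forall] at hb'
  obtain ⟨i, s, h⟩ := hb'
  refine ⟨fun i => G.mulVec (fun j => (y + z) (i, j)) s, ?_, fun h0 => h (congrFun h0 i), ?_⟩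
  · convert (rowSpace G).sum_mem fun j (_ : j ∈ Finset.univ) =>
      (rowSpace G).smul_mem (G s j) (hy j)
    rename_i i
    have h1 := congrFun (hz i) s
    simp only [Matrix.mulVec, dotProduct, Pi.zero_apply] at h1
    simp [Matrix.mulVec, dotProduct, mul_add, Finset.sum_add_distrib, h1]
  · intro i hi
    by_contra! h0
    exact hi (by simp only [Matrix.mulVec, dotProduct, h0, mul_zero, Finset.sum_const_zero])

end Product

/-! ### Rank and weights of the simplex code -/

section Simplex

variable {F : Type*} [Field F] {ι : Type*} {r : ℕ} {G : Matrix (Fin r) ι F}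
  (hG : IsSimplexGenerator G)
include hG

lemma IsSimplexGenerator.exists_smul_col {x : Fin r → F} (hx : x ≠ 0) :
    ∃ (c : Fˣ) (j : ι), c • G.col j = x := by
  obtain ⟨h0, -, hsurj⟩ := hG
  obtain ⟨j, hj⟩ := hsurj (Projectivization.mk F x hx)
  obtain ⟨c, hc⟩ := (Projectivization.mk_eq_mk_iff F _ _ _ _).1 hj.symm
  exact ⟨c, j, hc⟩

lemma IsSimplexGenerator.exists_right_inverse [Fintype ι] [DecidableEq ι] :
    ∃ P : Matrix ι (Fin r) F, G * P = 1 := by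
  rw [← Matrix.mulVec_surjective_iff_exists_right_inverse]
  intro x
  by_cases hx : x = 0
  · exact ⟨0, by rw [hx, Matrix.mulVec_zero]⟩
  · obtain ⟨c, j, rfl⟩ := hG.exists_smul_col hx
    exact ⟨c • Pi.single j 1, by rw [Matrix.mulVec_smul, Matrix.mulVec_single_one]⟩

lemma IsSimplexGenerator.card_eq [Fintype F] [Fintype ι] :
    Fintype.card ι = (Fintype.card F ^ r - 1) / (Fintype.card F - 1) := by
  obtain ⟨_, hbij⟩ := hG
  rw [← Nat.card_eq_fintype_card, Nat.card_eq_of_bijective _ hbij, Projectivization.card'']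
  simp

/-- All nonzero codewords of a simplex code have weight `q ^ (r - 1)`. -/
lemma IsSimplexGenerator.ncard_support [Fintype F] {u : Fin r → F} (hu : u ≠ 0) :
    {j | Matrix.vecMul u G j ≠ 0}.ncard = Fintype.card F ^ (r - 1) := by
  -- Each vector off the hyperplane `u^⊥` is a unit times a column of `G`, in a unique way. Hence `q
  -- - 1` times the weight is `q^r - q^(r-1)`.
  have h1 : Nat.card (Fˣ × {j | Matrix.vecMul u G j ≠ 0}) = Nat.card {x | u ⬝ᵥ x ≠ 0} := by
    refine Nat.card_eq_of_bijective
      (fun cj => ⟨cj.1 • G.col cj.2, ?_⟩) ⟨?_, ?_⟩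
    · change u ⬝ᵥ (cj.1 • G.col cj.2) ≠ 0
      rw [Units.smul_def, dotProduct_smul, smul_eq_mul]
      exact mul_ne_zero cj.1.ne_zero cj.2.2
    · rintro ⟨c, j, hj⟩ ⟨c', j', hj'⟩ h
      replace h : c • G.col j = c' • G.col j' := congrArg Subtype.val h
      obtain ⟨h0, hinj, -⟩ := hG
      obtain rfl : j = j' := by
        refine hinj ((Projectivization.mk_eq_mk_iff F _ _ _ _).2 ⟨c⁻¹ * c', ?_⟩)
        rw [mul_smul, ← h, inv_smul_smul]
      rw [Units.smul_def, Units.smul_def] at h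
      rw [Units.ext (smul_left_injective F (h0 j) h)]
    · rintro ⟨x, hx⟩
      obtain ⟨c, j, rfl⟩ := hG.exists_smul_col (x := x) (by rintro rfl; simp at hx)
      refine ⟨⟨c, j, fun h => hx ?_⟩, rfl⟩
      rw [Units.smul_def, dotProduct_smul]
      exact (congrArg _ h).trans (smul_zero _)
  have hr : r - 1 + 1 = r := by
    refine Nat.sub_add_cancel (Nat.one_le_iff_ne_zero.2 ?_)
    rintro rfl
    exact hu (Subsingleton.elim _ _)
  let f : Module.Dual F (Fin r → F) := dotProductEquiv F (Fin r) u
  have hf : f ≠ 0 := (LinearEquiv.map_ne_zero_iff _).2 hu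
  have hker : Module.finrank F (LinearMap.ker f) = r - 1 := by
    have := Module.Dual.finrank_ker_add_one_of_ne_zero hf
    rw [Module.finrank_fin_fun] at this
    omega
  have h2 : (LinearMap.ker f : Set (Fin r → F)).ncard = Fintype.card F ^ (r - 1) := by
    rw [← Nat.card_coe_set_eq, SetLike.coe_sort_coe, Module.natCard_eq_pow_finrank (K := F), hker, Nat.card_eq_fintype_card]
  have h3 := Set.ncard_add_ncard_compl (LinearMap.ker f : Set (Fin r → F))
  rw [show (LinearMap.ker f : Set (Fin r → F))ᶜ = {x | u ⬝ᵥ x ≠ 0} from rfl,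
    h2, ← Nat.card_coe_set_eq, ← h1, Nat.card_prod, Nat.card_coe_set_eq,
    Nat.card_units, Nat.card_eq_fintype_card, Nat.card_eq_fintype_card,
    Fintype.card_fun, Fintype.card_fin] at h3
  have hq : 1 < Fintype.card F := Fintype.one_lt_card
  refine Nat.eq_of_mul_eq_mul_left (Nat.sub_pos_of_lt hq) (Nat.add_left_cancel (h3.trans ?_))
  conv_lhs => rw [← hr, pow_succ]
  rw [Nat.sub_mul, one_mul, mul_comm, Nat.add_sub_cancel']
  exact Nat.le_mul_of_pos_left _ (by omega)

end Simplex

/-! ### The minimum distance -/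

section Distance

variable {F : Type*} [Field F] [Fintype F] {ι Q : Type*} [Fintype Q] {r : ℕ}
  {G : Matrix (Fin r) ι F}

/-- Here `f` will be a coordinate projection of the lattice: the operator's support has at least as
many points as its projection, which covers the support of `v`. -/
lemma IsSimplexGenerator.le_weight (hG : IsSimplexGenerator G) {v : ι → F} (hv : v ∈ rowSpace G)
    (hv0 : v ≠ 0) {b a : Q → F} (f : Q → ι)
    (h : ∀ j, v j ≠ 0 → ∃ x, f x = j ∧ (b x ≠ 0 ∨ a x ≠ 0)) :
    Fintype.card F ^ (r - 1) ≤ weight b a := by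
  obtain ⟨u, rfl⟩ := (mem_rowSpace_iff G v).1 hv
  rw [← hG.ncard_support (u := u) (by rintro rfl; simp at hv0), weight]
  refine (Set.ncard_le_ncard (t := f '' {x | b x ≠ 0 ∨ a x ≠ 0}) ?_).trans (Set.ncard_image_le)
  intro j hj
  obtain ⟨x, rfl, hx⟩ := h j hj
  exact ⟨x, hx, rfl⟩

variable [Fintype ι] [DecidableEq ι] {κ : Type*} {H : Matrix κ ι F}

lemma isLeast_weight (p : ℕ) [Fact p.Prime] [Algebra (ZMod p) F] (hr : r ≠ 0)
    (hG : IsSimplexGenerator G) (hH : IsParityCheck H (rowSpace G)) :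
    IsLeast {w : ℕ | ∃ c ∈ phases p, ∃ b a : ι × ι → F,
      pauli p c b a ∈ pauliCentralizer p (cssStabilizer p (shpGauge p H)) ∧
      pauli p c b a ∉ shpGauge p H ∧ weight b a = w} (Fintype.card F ^ (r - 1)) := by
  simp only [shpGauge, cssGauge_eq, pauliCentralizer_cssStabilizer, pauli_mem_pauliSubgroup]
  constructor
  · have : NeZero r := ⟨hr⟩
    set u : Fin r → F := Pi.single 0 1 with hu
    have hu0 : u ≠ 0 := by simp [hu]
    have hw := hG.ncard_support hu0
    obtain ⟨i₀, hi₀⟩ : {j | Matrix.vecMul u G j ≠ 0}.Nonempty := by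
      rw [← Set.ncard_pos, hw]
      exact pow_pos Fintype.card_pos _
    -- A codeword is placed in row `i₀`. As `i₀` is in its support, column `i₀` of `a` is a nonzero
    -- multiple of a unit vector, which `G` does not kill, so `X^a` is not a gauge operator.
    let a : ι × ι → F := fun ij => if ij.1 = i₀ then Matrix.vecMul u G ij.2 else 0
    refine ⟨1, one_mem _, 0, a, ⟨one_mem _, zero_mem _, Submodule.mem_sup_left ?_⟩, ?_, ?_⟩
    · rw [mem_perp_rowSpace_one_kronecker hH]
      intro i
      by_cases hi : i = i₀
      · simpa [a, hi] using (mem_rowSpace_iff G _).2 ⟨u, rfl⟩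
      · simp only [a, hi, if_false]
        exact zero_mem (rowSpace G)
    · rintro ⟨-, -, h⟩
      rw [mem_rowSpace_kronecker_one hH] at h
      obtain ⟨h0, -⟩ := hG
      refine h0 i₀ (funext fun s => ?_)
      have := congrFun (h i₀) s
      simpa [a, Matrix.mulVec, dotProduct, show Matrix.vecMul u G i₀ ≠ 0 from hi₀] using this
    · rw [← hw, weight, ← Set.ncard_image_of_injective {j | Matrix.vecMul u G j ≠ 0} (Prod.mk_right_injective i₀)]
      refine congrArg Set.ncard (Set.ext ?_)
      rintro ⟨i, j⟩
      simp only [a, Pi.zero_apply, ne_eq, not_true_eq_false, false_or, Set.mem_ofPred_eq,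
        Set.mem_image, Prod.mk.injEq]
      constructor
      · intro h
        by_cases hi : i = i₀
        · exact ⟨j, by simpa [hi] using h, hi.symm, rfl⟩
        · simp [hi] at h
      · rintro ⟨j, h, rfl, rfl⟩
        simpa using h
  · rintro _ ⟨c, hc, b, a, ⟨-, hb, ha⟩, h, rfl⟩
    by_cases hb' : b ∈ rowSpace ((1 : Matrix ι ι F) ⊗ₖ H)
    · obtain ⟨v, hv, hv0, hva⟩ := exists_codeword_of_columns hH ha fun ha' => h ⟨hc, hb', ha'⟩
      refine hG.le_weight hv hv0 Prod.snd fun j hj => ?_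
      obtain ⟨i, hi⟩ := hva j hj
      exact ⟨(i, j), rfl, Or.inr hi⟩
    · obtain ⟨v, hv, hv0, hvb⟩ := exists_codeword_of_rows hH hb hb'
      refine hG.le_weight hv hv0 Prod.fst fun i hi => ?_
      obtain ⟨j, hj⟩ := hvb i hi
      exact ⟨(i, j), rfl, Or.inl hj⟩

end Distance

end Qudit

theorem mainTheorem8 (p : ℕ) [Fact p.Prime] {F : Type*} [Field F] [Fintype F]
    [Algebra (ZMod p) F] (q : ℕ) (hq : Fintype.card F = q) (r : ℕ) (hr : 3 ≤ r)
    {ι κ : Type*} [Fintype ι] [DecidableEq ι] [Fintype κ]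
    (G : Matrix (Fin r) ι F) (hG : Qudit.IsSimplexGenerator G)
    (H : Matrix κ ι F) (hH : Qudit.IsParityCheck H (Qudit.rowSpace G)) :
    Qudit.IsSubsystemCode p (Qudit.shpGauge p H) (Qudit.cssStabilizer p (Qudit.shpGauge p H))
      (((q ^ r - 1) / (q - 1)) ^ 2) (r ^ 2) (q ^ (r - 1)) := by
  subst hq
  have hgauge := Qudit.cssGauge_eq p (H ⊗ₖ (1 : Matrix ι ι F)) ((1 : Matrix ι ι F) ⊗ₖ H)
  refine ⟨?_, ?_, ?_, ?_, Qudit.isLeast_weight p (by omega) hG hH⟩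
  · rw [Qudit.shpGauge, hgauge]
    exact Qudit.pauliSubgroup_le_pauliGroup p _ _
  · rw [Qudit.shpGauge, hgauge]
    exact Qudit.isStabilizerOf_cssStabilizer p _ _
  · rw [Fintype.card_prod, ← hG.card_eq, sq]
  · obtain ⟨P, hP⟩ := hG.exists_right_inverse
    obtain ⟨γ, hγ⟩ := Qudit.exists_isComplementMap_logical hH hP
    rw [Qudit.shpGauge, hgauge]
    -- The logical qudits, indexed by pairs in `Fin r × Fin r`, are renumbered by `Fin (r ^ 2)`.
    exact Qudit.exists_encodes p _ _
      (hγ.comp_equiv ((finCongr (sq r)).trans finProdFinEquiv.symm))
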